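/- Let $G$ be a finite simple graph with vertex set $\{x_1,\dots,x_n\}$, let $\mathbb K$ be a field, let $S=\mathbb K[x_1,\dots,x_n]$, and let $I(G)=(x_ix_j \mid x_ix_j\in E(G))\subseteq S$ be the edge ideal of $G$. For an ideal $I$ of $S$ let $I^{(2)}=\bigcap_{\mathfrak p\in \mathrm{Min}(I)}\ker\bigl(S\to (S/I^2)_{\mathfrak p}\bigr)$ be its second symbolic power, where $\mathrm{Min}(I)$ is the set of minimal primes of $I$. The star with center $x$ is the subgraph $\mathrm{St}(x)$ of $G$ with vertex set $N_G[x]$ (the closed neighborhood of $x$) and edge set $\{xy\mid y\in N_G(x)\}$, and the star packing number $\alpha_2(G)$ is the largest number of stars in a family of stars of $G$ with pairwise disjoint vertex sets. Then $$\operatorname{depth} S/I(G)^{(2)}\ \ge\ \alpha_2(G)-1,$$ where the depth is the maximal length of an $S/I(G)^{(2)}$-regular sequence contained in the ideal $(x_1,\dots,x_n)$. -/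

import Mathlib

open MvPolynomial

/-- The edge ideal `I(G) = (xᵢ xⱼ | xᵢxⱼ ∈ E(G))` in the polynomial ring over `K` whose variables
are the vertices of `G`. -/
noncomputable def edgeIdeal (K : Type*) [Field K] {V : Type*} (G : SimpleGraph V) : Ideal (MvPolynomial V K) :=
  Ideal.span {u | ∃ x y : V, G.Adj x y ∧ u = X x * X y}

/-- The `s`-th symbolic power `I^(s)`: the intersection, over the minimal primes `p` of `I`, of the
kernels of the canonical maps `R → (R ⧸ I ^ s)_p`. -/
noncomputable def symbolicPower {R : Type*} [CommRing R] (I : Ideal R) (s : ℕ) : Ideal R :=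
  ⨅ (p : Ideal R) (hp : p ∈ I.minimalPrimes),
    haveI : p.IsPrime := hp.1.1
    LinearMap.ker
      ((LocalizedModule.mkLinearMap p.primeCompl (R ⧸ I ^ s)).comp (Submodule.mkQ (I ^ s)))

/-- The depth of an `R`-module `M` with respect to an ideal `J`: the supremum of the lengths of the
`M`-regular sequences contained in `J`. -/
noncomputable def depthIn {R : Type*} [CommRing R] (J : Ideal R)
    (M : Type*) [AddCommGroup M] [Module R M] : ℕ∞ :=
  ⨆ (rs : List R) (_ : (∀ r ∈ rs, r ∈ J) ∧ RingTheory.Sequence.IsRegular M rs), (rs.length : ℕ∞)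

/-- The depth of a module over a polynomial ring over a field, taken as usual with respect to the
homogeneous maximal ideal, which is generated by the variables. -/
noncomputable def polyDepth (K : Type*) [Field K] (V : Type*)
    (M : Type*) [AddCommGroup M] [Module (MvPolynomial V K) M] : ℕ∞ :=
  depthIn (idealOfVars V K) M

/-- The star `St(x)` with center `x`: the subgraph of `G` with vertex set `N_G[x]` and edge set
`{xy | y ∈ N_G(x)}`. -/
def starSubgraph {V : Type*} (G : SimpleGraph V) (x : V) : G.Subgraph where
  verts := insert x (G.neighborSet x)
  Adj a b := G.Adj a b ∧ (a = x ∨ b = x)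
  adj_sub h := h.1
  edge_vert := by
    rintro a b ⟨h, rfl | rfl⟩
    · exact Set.mem_insert _ _
    · exact Set.mem_insert_of_mem _ h.symm
  symm := ⟨fun _ _ h => ⟨h.1.symm, h.2.symm⟩⟩

/-- A star packing of `G` is a family of stars in `G` with pairwise disjoint vertex sets. -/
def IsStarPacking {V : Type*} (G : SimpleGraph V) (F : Set G.Subgraph) : Prop :=
  (∀ T ∈ F, ∃ x : V, T = starSubgraph G x) ∧ F.Pairwise fun T T' => Disjoint T.verts T'.verts

/-- The star packing number `α₂(G)`: the largest number of stars in a star packing of `G`. -/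
noncomputable def starPackingNumber {V : Type*} (G : SimpleGraph V) : ℕ∞ :=
  ⨆ (F : Set G.Subgraph) (_ : IsStarPacking G F), F.encard

open scoped Pointwise

/-! Let `Sᵢ`, `i = 0,…,n`, be the closed neighbourhoods of the centers of a star packing and `ℓᵢ`
the sum of the variables in `Sᵢ`. The `n` forms `ℓᵢ + ℓₙ`, `i < n`, are a regular sequence on
`S/I(G)^(2)`. Modulo a set `B` of variables this is linear algebra: it suffices that at most one
`Sᵢ` lies inside `B` (`regularOnExponents_cover`). The sequences `0 → R/(J:u) → R/J → R/(J,u) → 0`,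
along which weak regularity of a fixed list propagates (`WeaklyRegularMod.of_colon`), reduce to that
case.

The ideal `I(G)^(2)` is spanned by the monomials of degree at least 2 on every vertex cover
(`symbolicPower_edgeIdeal_two`). Adding edges `xy` one at a time ends at `I(G)`. Each colon by `xy`
that is met is the unit ideal, or the edge ideal of `G` with `N(x)` joined to `N(y)`, plus a set of
variables (`colon_edgeExponents`).

Such edge ideals are split at variables `v`: the colon adds `N(v)` to `B`, the sum adds `v`. If `v`
is never a tracked center, each tracked star keeps a vertex outside `B`. After a colon by `xy` the
stars through `x` or `y` are not tracked; there are at most two, and `x` or `y` itself survives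
(`regularOnExponents_stars_and_edge`). So at most one star is lost, which accounts for the `-1`. -/

/-- A list of elements is weakly regular modulo the ideal `J`. -/
def WeaklyRegularMod {R : Type*} [CommRing R] : Ideal R → List R → Prop
  | _, [] => True
  | J, r :: rs => (∀ f, r * f ∈ J → f ∈ J) ∧ WeaklyRegularMod (J ⊔ Ideal.span {r}) rs

/-! ### Weakly regular sequences and colon ideals. -/

section WeaklyRegular

variable {R : Type*} [CommRing R]

theorem WeaklyRegularMod.isWeaklyRegular {J : Ideal R} {rs : List R}
    (h : WeaklyRegularMod J rs) : RingTheory.Sequence.IsWeaklyRegular (R ⧸ J) rs := by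
  induction rs generalizing J with
  | nil => exact .nil R _
  | cons r rs ih =>
    refine .cons ?_ ?_
    · rw [isSMulRegular_quotient_iff_mem_of_smul_mem]
      exact h.1
    · have e : (r • ⊤ : Submodule R (R ⧸ J)) =
          Submodule.map (Submodule.mkQ J) (Ideal.span {r} : Submodule R R) := by
        rw [← Submodule.ideal_span_singleton_smul]
        conv_rhs => rw [← Ideal.mul_top (Ideal.span {r}), ← smul_eq_mul, Submodule.map_smul'']
        rw [Submodule.map_top, Submodule.range_mkQ]
      let e' : QuotSMulTop r (R ⧸ J) ≃ₗ[R] R ⧸ (J ⊔ Ideal.span {r}) :=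
        (Submodule.quotEquivOfEq _ _ e).trans
          (Submodule.quotientQuotientEquivQuotientSup J (Ideal.span {r}))
      exact (LinearEquiv.isWeaklyRegular_congr e' rs).2 (ih h.2)

theorem weaklyRegularMod_top (rs : List R) : WeaklyRegularMod (⊤ : Ideal R) rs := by
  induction rs with
  | nil => trivial
  | cons r rs ih => exact ⟨fun _ _ => trivial, by rwa [top_sup_eq]⟩

theorem mem_sup_span {J : Ideal R} {u f : R} :
    f ∈ J ⊔ Ideal.span {u} ↔ ∃ j ∈ J, ∃ c, f = j + c * u := by
  rw [Submodule.mem_sup]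
  constructor
  · rintro ⟨j, hj, y, hy, rfl⟩
    obtain ⟨c, rfl⟩ := Ideal.mem_span_singleton'.1 hy
    exact ⟨j, hj, c, rfl⟩
  · rintro ⟨j, hj, c, rfl⟩
    exact ⟨j, hj, _, Ideal.mem_span_singleton'.2 ⟨c, rfl⟩, rfl⟩

/-- Weak regularity passes to the middle term of `0 → R/(J:u) → R/J → R/(J,u) → 0`. -/
theorem WeaklyRegularMod.of_colon {J J' : Ideal R} {u : R} (hJ' : ∀ f, f ∈ J' ↔ f * u ∈ J)
    {rs : List R} (h₁ : WeaklyRegularMod J' rs) (h₂ : WeaklyRegularMod (J ⊔ Ideal.span {u}) rs) :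
    WeaklyRegularMod J rs := by
  induction rs generalizing J J' with
  | nil => trivial
  | cons r rs ih =>
    -- The induction continues because `(J + (r)) : u = (J : u) + (r)`, which holds since `r` is
    -- regular modulo `J + (u)`.
    refine ⟨fun f hf => ?_, ih (J' := J' ⊔ Ideal.span {r}) (fun f => ?_) h₁.2 ?_⟩
    · obtain ⟨j, hj, c, rfl⟩ := mem_sup_span.1 (h₂.1 f (Ideal.mem_sup_left hf))
      refine add_mem hj ((hJ' c).1 (h₁.1 c ((hJ' _).2 ?_)))
      have h := sub_mem hf (J.mul_mem_left r hj)
      convert h using 1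
      ring
    · constructor
      · intro hf
        obtain ⟨j, hj, c, rfl⟩ := mem_sup_span.1 hf
        exact mem_sup_span.2 ⟨j * u, (hJ' j).1 hj, c * u, by ring⟩
      · intro hf
        obtain ⟨j, hj, b, hb⟩ := mem_sup_span.1 hf
        have hb' : b ∈ J ⊔ Ideal.span {u} := by
          refine h₂.1 b (mem_sup_span.2 ⟨-j, neg_mem hj, f, ?_⟩)
          linear_combination -hb
        obtain ⟨j', hj', c, rfl⟩ := mem_sup_span.1 hb'
        refine mem_sup_span.2 ⟨f - c * r, (hJ' _).2 ?_, c, by ring⟩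
        have h := add_mem hj (J.mul_mem_left r hj')
        convert h using 1
        linear_combination hb
    · rw [sup_right_comm]; exact h₂.2

end WeaklyRegular

/-! ### Ideals generated by linear forms. -/

section LinearForms

variable {K : Type*} [Field K] {V : Type*} [Fintype V]

/-- The linear form with the given coefficients. -/
noncomputable def linForm : (V → K) →ₗ[K] MvPolynomial V K :=
  Fintype.linearCombination K X

/-- The ideal generated by a space of linear forms. -/
noncomputable def linIdeal (W : Submodule K (V → K)) : Ideal (MvPolynomial V K) :=
  Ideal.span (linForm '' (W : Set (V → K)))

theorem linForm_injective : Function.Injective (linForm : (V → K) →ₗ[K] MvPolynomial V K) :=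
  (linearIndependent_X V K).fintypeLinearCombination_injective

theorem linForm_single [DecidableEq V] (v : V) :
    linForm (Pi.single v (1 : K)) = (X v : MvPolynomial V K) := by
  simp [linForm]

theorem linForm_mem_linIdeal {W : Submodule K (V → K)} {a : V → K} (ha : a ∈ W) :
    linForm a ∈ linIdeal W := Ideal.subset_span ⟨a, ha, rfl⟩

theorem linIdeal_sup_span (W : Submodule K (V → K)) (a : V → K) :
    linIdeal W ⊔ Ideal.span {linForm a} = linIdeal (W ⊔ K ∙ a) := by
  apply le_antisymm
  · refine sup_le (Ideal.span_mono (Set.image_mono (SetLike.coe_subset_coe.2 le_sup_left))) ?_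
    rw [Ideal.span_singleton_le_iff_mem]
    exact linForm_mem_linIdeal (Submodule.mem_sup_right (Submodule.mem_span_singleton_self a))
  · refine Ideal.span_le.2 ?_
    rintro _ ⟨b, hb, rfl⟩
    obtain ⟨w, hw, c, hc, rfl⟩ := Submodule.mem_sup.1 hb
    obtain ⟨t, rfl⟩ := Submodule.mem_span_singleton.1 hc
    rw [map_add, map_smul, MvPolynomial.smul_eq_C_mul]
    exact mem_sup_span.2 ⟨_, linForm_mem_linIdeal hw, _, rfl⟩

/-- The quotient embeds in the polynomial ring: a section `g` of the projection modulo `W` induces a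
substitution `φ` that kills `linIdeal W` and is the identity modulo it. -/
theorem mem_linIdeal_of_mul_mem {W : Submodule K (V → K)} {a : V → K} (ha : a ∉ W)
    {f : MvPolynomial V K} (hf : linForm a * f ∈ linIdeal W) : f ∈ linIdeal W := by
  classical
  obtain ⟨g, hg⟩ := W.mkQ.exists_rightInverse_of_surjective W.range_mkQ
  have hg' : ∀ y, W.mkQ (g y) = y := fun y => LinearMap.congr_fun hg y
  let φ : MvPolynomial V K →ₐ[K] MvPolynomial V K :=
    aeval fun v => linForm (g (W.mkQ (Pi.single v 1)))
  have hφ : ∀ b, φ (linForm b) = linForm (g (W.mkQ b)) := by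
    intro b
    have : φ.toLinearMap ∘ₗ linForm = linForm ∘ₗ g ∘ₗ W.mkQ := by
      ext v
      simp [linForm_single, φ]
    exact LinearMap.congr_fun this b
  have hker : ∀ p, φ p - p ∈ linIdeal W := by
    intro p
    rw [← Ideal.Quotient.eq]
    have : (Ideal.Quotient.mkₐ K (linIdeal W)).comp φ = Ideal.Quotient.mkₐ K (linIdeal W) := by
      ext v
      simp only [AlgHom.comp_apply, Ideal.Quotient.mkₐ_eq_mk]
      rw [Ideal.Quotient.eq, ← linForm_single, hφ, ← map_sub]
      apply linForm_mem_linIdeal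
      rw [← Submodule.Quotient.mk_eq_zero, ← Submodule.mkQ_apply, map_sub, hg', sub_self]
    exact DFunLike.congr_fun this p
  have hle : ∀ p ∈ linIdeal W, φ p = 0 := by
    have : linIdeal W ≤ RingHom.ker φ := by
      refine Ideal.span_le.2 ?_
      rintro _ ⟨b, hb, rfl⟩
      simp only [SetLike.mem_coe, RingHom.mem_ker]
      rw [hφ, Submodule.mkQ_apply, (Submodule.Quotient.mk_eq_zero W).2 hb, map_zero, map_zero]
    exact fun p hp => this hp
  have h0 := hle _ hf
  rw [map_mul, hφ, mul_eq_zero] at h0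
  rcases h0 with h0 | h0
  · refine absurd ?_ ha
    rw [← Submodule.Quotient.mk_eq_zero, ← Submodule.mkQ_apply, ← hg' (W.mkQ a),
      linForm_injective (h0.trans (map_zero linForm).symm), map_zero]
  · have := hker f
    rw [h0, zero_sub] at this
    exact neg_mem_iff.1 this

/-- Linear forms that are separated by functionals vanishing on `W` form a weakly regular sequence
modulo the ideal generated by `W`. -/
theorem weaklyRegularMod_linIdeal {ι : Type*} (a : ι → V → K) (ev : ι → (V → K) →ₗ[K] K)
    {l : List ι} (hl : l.Nodup) {W : Submodule K (V → K)} (hW : ∀ i ∈ l, W ≤ LinearMap.ker (ev i))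
    (hne : ∀ i ∈ l, ev i (a i) ≠ 0) (hz : ∀ i ∈ l, ∀ j ∈ l, i ≠ j → ev i (a j) = 0) :
    WeaklyRegularMod (linIdeal W) (l.map fun i => linForm (a i)) := by
  induction l generalizing W with
  | nil => trivial
  | cons i l ih =>
    have hn := List.nodup_cons.1 hl
    refine ⟨fun f hf => mem_linIdeal_of_mul_mem (fun h => hne i (by simp) (hW i (by simp) h)) hf, ?_⟩
    rw [linIdeal_sup_span]
    refine ih hn.2 (fun j hj => sup_le (hW j (by simp [hj])) ?_) (fun j hj => hne j (by simp [hj]))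
      (fun j hj k hk => hz j (by simp [hj]) k (by simp [hk]))
    rw [Submodule.span_singleton_le_iff_mem]
    exact hz j (by simp [hj]) i (by simp) (fun h => hn.1 (h ▸ hj))

end LinearForms

/-! ### Monomial ideals as upper sets of exponents. -/

section MonomialIdeals

variable {K : Type*} [Field K] {V : Type*}

/-- The list `rs` is weakly regular modulo the monomial ideal whose exponents are `U`. -/
def RegularOnExponents (rs : List (MvPolynomial V K)) (U : Set (V →₀ ℕ)) : Prop :=
  ∀ hU : IsUpperSet U, WeaklyRegularMod (restrictSupportIdeal K U hU) rs

theorem mem_restrictSupportIdeal {U : Set (V →₀ ℕ)} {hU : IsUpperSet U} {f : MvPolynomial V K} :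
    f ∈ restrictSupportIdeal K U hU ↔ ∀ m ∈ f.support, m ∈ U := Iff.rfl

/-- A colon by a monomial translates the exponent set and adding the monomial enlarges it by a
principal upper set, so the later splittings become pure combinatorics. -/
theorem RegularOnExponents.of_colon {rs : List (MvPolynomial V K)} {U : Set (V →₀ ℕ)} (e : V →₀ ℕ)
    (h₁ : RegularOnExponents rs {m | m + e ∈ U}) (h₂ : RegularOnExponents rs (U ∪ Set.Ici e)) :
    RegularOnExponents rs U := by
  intro hU
  have hU₁ : IsUpperSet {m | m + e ∈ U} := fun a b hab ha => hU (add_le_add_left hab e) ha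
  have hU₂ : IsUpperSet (U ∪ Set.Ici e) := hU.union (isUpperSet_Ici e)
  refine WeaklyRegularMod.of_colon (u := monomial e (1 : K)) (fun f => ?_) (h₁ hU₁) ?_
  · simp only [mem_restrictSupportIdeal, mem_support_iff, coeff_mul_monomial', Set.mem_ofPred_eq]
    constructor
    · intro h m hm
      split_ifs at hm with hle
      · rw [← tsub_add_cancel_of_le hle]
        exact h _ (by simpa using hm)
      · exact absurd rfl hm
    · intro h m hm
      exact h (m + e) (by simpa using hm)
  · convert h₂ hU₂ using 1
    apply le_antisymm
    · refine sup_le (fun f hf m hm => Or.inl (hf hm)) ?_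
      rw [Ideal.span_singleton_le_iff_mem, mem_restrictSupportIdeal]
      intro m hm
      rw [Finset.mem_singleton.1 (support_monomial_subset hm)]
      exact Or.inr Set.self_mem_Ici
    · intro f hf
      rw [← f.support_sum_monomial_coeff]
      refine Ideal.sum_mem _ fun m hm => ?_
      rcases hf hm with h | h
      · refine Ideal.mem_sup_left ?_
        rw [mem_restrictSupportIdeal]
        intro m' hm'
        rwa [Finset.mem_singleton.1 (support_monomial_subset hm')]
      · refine Ideal.mem_sup_right (Ideal.mem_span_singleton'.2 ⟨monomial (m - e) (coeff m f), ?_⟩)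
        rw [monomial_mul, mul_one, tsub_add_cancel_of_le h]

theorem regularOnExponents_of_zero_mem (rs : List (MvPolynomial V K)) {U : Set (V →₀ ℕ)}
    (h0 : 0 ∈ U) : RegularOnExponents rs U := by
  intro hU
  have : restrictSupportIdeal K U hU = (⊤ : Ideal (MvPolynomial V K)) :=
    eq_top_iff.2 fun f _ m _ => hU (zero_le (a := m)) h0
  rw [this]
  exact weaklyRegularMod_top rs

end MonomialIdeals

/-! ### The sequence modulo a set of variables. -/

section Leaves

variable {K : Type*} [Field K] {V : Type*} [Fintype V]

theorem span_X_eq_linIdeal (B : Set V) :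
    Ideal.span (X '' B) = linIdeal (Submodule.pi Bᶜ fun _ => (⊥ : Submodule K K)) := by
  classical
  apply le_antisymm
  · refine Ideal.span_le.2 ?_
    rintro _ ⟨b, hb, rfl⟩
    rw [← linForm_single]
    refine linForm_mem_linIdeal ?_
    rw [Submodule.mem_pi]
    intro v hv
    have : v ≠ b := fun h => hv (h ▸ hb)
    exact (Submodule.mem_bot K).2 (Pi.single_eq_of_ne this _)
  · refine Ideal.span_le.2 ?_
    rintro _ ⟨a, ha, rfl⟩
    rw [linForm, Fintype.linearCombination_apply]
    refine Ideal.sum_mem _ fun v _ => ?_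
    by_cases hv : v ∈ B
    · rw [smul_eq_C_mul]
      exact Ideal.mul_mem_left _ _ (Ideal.subset_span ⟨v, hv, rfl⟩)
    · have : a v = 0 := Submodule.mem_pi.1 ha v hv
      simp [this]

/-- The linear forms `∑_{v ∈ S i} v + ∑_{v ∈ S n} v` for `i < n`. -/
noncomputable def sumForms (K : Type*) [Field K] {n : ℕ} (S : Fin (n + 1) → Set V) :
    List (MvPolynomial V K) :=
  (List.finRange n).map fun i =>
    linForm ((S i.castSucc).indicator 1 + (S (Fin.last n)).indicator 1)

/-- Evaluations at the surviving vertices `z i ∉ B` vanish on the variables in `B` and separate the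
forms. The index `i₀` is the one star that `B` may swallow. -/
theorem regularOnExponents_cover [Nonempty V] {n : ℕ} {S : Fin (n + 1) → Set V}
    (hS : Pairwise fun i j => Disjoint (S i) (S j)) {B : Set V} {i₀ : Fin (n + 1)}
    (hB : ∀ i ≠ i₀, ∃ z ∈ S i, z ∉ B) :
    RegularOnExponents (sumForms K S) {m | ∃ b ∈ B, m b ≠ 0} := by
  classical
  intro hU
  have hJ : restrictSupportIdeal K {m : V →₀ ℕ | ∃ b ∈ B, m b ≠ 0} hU =
      linIdeal (Submodule.pi Bᶜ fun _ => (⊥ : Submodule K K)) := by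
    rw [← span_X_eq_linIdeal]
    ext f
    rw [mem_ideal_span_X_image]
    exact Iff.rfl
  rw [hJ]
  choose! z hz hzB using hB
  have hχ : ∀ k ≠ i₀, ∀ j, (S j).indicator (1 : V → K) (z k) = if j = k then 1 else 0 := by
    intro k hk j
    split_ifs with h
    · subst h
      simp [hz j hk]
    · exact Set.indicator_of_notMem (fun hj => Set.disjoint_left.1 (hS h) hj (hz k hk)) _
  -- If `i₀ < n`, no vertex of `S i₀` is available to detect its form. The last star detects it, but
  -- also every other form; the subtracted evaluations cancel those.
  let ev : Fin n → (V → K) →ₗ[K] K := fun i =>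
    if i.castSucc = i₀ then
      LinearMap.proj (z (Fin.last n)) - ∑ j ∈ Finset.univ.erase i, LinearMap.proj (z j.castSucc)
    else LinearMap.proj (z i.castSucc)
  have hlast : ∀ i : Fin n, i.castSucc ≠ Fin.last n := fun i => (Fin.castSucc_lt_last i).ne
  have hev : ∀ i j : Fin n, ev i ((S j.castSucc).indicator 1 + (S (Fin.last n)).indicator 1) =
      if i = j then 1 else 0 := by
    intro i j
    by_cases hi : i.castSucc = i₀
    · have hl : Fin.last n ≠ i₀ := fun h => hlast i (hi.trans h.symm)
      have hk : ∀ k ∈ Finset.univ.erase i, (S j.castSucc).indicator (1 : V → K) (z k.castSucc) +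
          (S (Fin.last n)).indicator (1 : V → K) (z k.castSucc) = if j = k then 1 else 0 := by
        intro k hk
        have hk' : k.castSucc ≠ i₀ := fun h =>
          Finset.ne_of_mem_erase hk (Fin.castSucc_injective n (h.trans hi.symm))
        rw [hχ _ hk', hχ _ hk', if_neg (hlast k).symm, add_zero]
        simp
      simp only [ev, if_pos hi, LinearMap.sub_apply, LinearMap.sum_apply, LinearMap.proj_apply,
        Pi.add_apply]
      rw [Finset.sum_congr rfl hk, hχ _ hl, hχ _ hl, if_neg (hlast j), Finset.sum_ite_eq]
      by_cases hij : i = j <;> simp [hij, eq_comm]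
    · simp only [ev, if_neg hi, LinearMap.proj_apply, Pi.add_apply]
      rw [hχ _ hi, hχ _ hi, if_neg (hlast i).symm, add_zero]
      simp [eq_comm]
  refine weaklyRegularMod_linIdeal _ ev (List.nodup_finRange n) (fun i _ a ha => ?_)
    (fun i _ => by simp [hev]) (fun i _ j _ hij => by simp [hev, hij])
  have hz0 : ∀ k ≠ i₀, a (z k) = 0 := fun k hk => Submodule.mem_pi.1 ha _ (hzB k hk)
  rw [LinearMap.mem_ker]
  by_cases hi : i.castSucc = i₀
  · have hl : Fin.last n ≠ i₀ := fun h => hlast i (hi.trans h.symm)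
    simp only [ev, if_pos hi, LinearMap.sub_apply, LinearMap.sum_apply, LinearMap.proj_apply,
      hz0 _ hl, zero_sub, neg_eq_zero]
    refine Finset.sum_eq_zero fun k hk => hz0 _ fun h => ?_
    exact Finset.ne_of_mem_erase hk (Fin.castSucc_injective n (h.trans hi.symm))
  · simp only [ev, if_neg hi, LinearMap.proj_apply, hz0 _ hi]

end Leaves

/-! ### Branching on variables while keeping stars alive. -/

section Branching

variable {V : Type*}

/-- Exponents of the monomials divisible by a variable in `B` or by `ab` for some related `a`,
`b`. -/
def relExponents (r : V → V → Prop) (B : Set V) : Set (V →₀ ℕ) :=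
  {m | (∃ b ∈ B, m b ≠ 0) ∨ ∃ a b, r a b ∧ m a ≠ 0 ∧ m b ≠ 0}

/-- `z` is a vertex outside `B` all of whose neighbours are in `B`. -/
def IsFree (r : V → V → Prop) (B : Set V) (z : V) : Prop :=
  z ∉ B ∧ ∀ w, r z w → w ∈ B

theorem IsFree.union_nbr {r : V → V → Prop} (hr : ∀ ⦃a b⦄, r a b → r b a) {B : Set V} {z v : V}
    (hz : IsFree r B z) (hv : v ∉ B) : IsFree r (B ∪ {w | r v w}) z :=
  ⟨fun h => h.elim hz.1 fun h => hv (hz.2 v (hr h)), fun w hw => Or.inl (hz.2 w hw)⟩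

theorem IsFree.insert {r : V → V → Prop} {B : Set V} {z v w : V}
    (hz : IsFree r B z) (hvw : r v w) (hw : w ∉ B) : IsFree r (insert v B) z := by
  refine ⟨fun h => h.elim ?_ hz.1, fun w hw => Or.inr (hz.2 w hw)⟩
  rintro rfl
  exact hw (hz.2 w hvw)

/-- Either the center `c` is outside `B`, or some vertex of `S` is free. -/
def IsLive (r : V → V → Prop) (c : V) (S : Set V) (B : Set V) : Prop :=
  c ∉ B ∨ ∃ z ∈ S, IsFree r B z

/-- If the center is swallowed, then `v` is a neighbour of it, so `v` lies in `S` and has itself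
become free. -/
theorem IsLive.union_nbr {r : V → V → Prop} (hr : ∀ ⦃a b⦄, r a b → r b a) {c : V} {S B : Set V} {v : V}
    (hS : ∀ w, r c w → w ∈ S) (h : IsLive r c S B) (hv : v ∉ B) (hvv : ¬ r v v) :
    IsLive r c S (B ∪ {w | r v w}) := by
  rcases h with h | ⟨z, hz, hf⟩
  · by_cases hvc : r v c
    · exact Or.inr ⟨v, hS v (hr hvc), fun h => h.elim hv hvv, fun w hw => Or.inr hw⟩
    · exact Or.inl fun h' => h'.elim h hvc
  · exact Or.inr ⟨z, hz, hf.union_nbr hr hv⟩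

/-- The neighbour `w` outside `B` shows that `v` is not a free vertex, so no witness of liveness is
lost. -/
theorem IsLive.insert {r : V → V → Prop} {c : V} {S B : Set V} {v w : V}
    (h : IsLive r c S B) (hvc : v ≠ c) (hvw : r v w) (hw : w ∉ B) :
    IsLive r c S (insert v B) := by
  rcases h with h | ⟨z, hz, hf⟩
  · exact Or.inl fun h' => h'.elim (fun h => hvc h.symm) h
  · exact Or.inr ⟨z, hz, hf.insert hvw hw⟩

theorem IsLive.exists_notMem {r : V → V → Prop} {c : V} {S B : Set V} (h : IsLive r c S B)
    (hc : c ∈ S) : ∃ z ∈ S, z ∉ B := by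
  rcases h with h | ⟨z, hz, hf⟩
  exacts [⟨c, hc, h⟩, ⟨z, hz, hf.1⟩]

variable {K : Type*} [Field K]

theorem relExponents_of_cover {r : V → V → Prop} {B : Set V} (h : ∀ a b, r a b → a ∈ B ∨ b ∈ B) :
    relExponents r B = {m | ∃ b ∈ B, m b ≠ 0} := by
  ext m
  refine ⟨fun hm => hm.elim id ?_, Or.inl⟩
  rintro ⟨a, b, hab, ha, hb⟩
  exact (h a b hab).elim (fun h => ⟨a, h, ha⟩) fun h => ⟨b, h, hb⟩

/-- The colon by the variable `v` turns each edge `vw` into the variable `w`. -/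
theorem regularOnExponents_branch {rs : List (MvPolynomial V K)} {r : V → V → Prop}
    (hr : ∀ ⦃a b⦄, r a b → r b a) {B : Set V} {v : V} (hv : v ∉ B) (hvv : ¬ r v v)
    (h₁ : RegularOnExponents rs (relExponents r (B ∪ {w | r v w})))
    (h₂ : RegularOnExponents rs (relExponents r (insert v B))) :
    RegularOnExponents rs (relExponents r B) := by
  classical
  have hs : ∀ (m : V →₀ ℕ) w, (m + Finsupp.single v 1 : V →₀ ℕ) w ≠ 0 ↔ m w ≠ 0 ∨ w = v := by
    intro m w
    rw [Finsupp.add_apply, Finsupp.single_apply]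
    split_ifs with h
    · simp [h]
    · simp [Ne.symm h]
  refine .of_colon (Finsupp.single v 1) ?_ ?_
  · convert h₁ using 1
    ext m
    simp only [relExponents, Set.mem_ofPred_eq, hs]
    constructor
    · rintro (⟨b, hb, h | rfl⟩ | ⟨a, b, hab, ha | rfl, hb | rfl⟩)
      · exact Or.inl ⟨b, Or.inl hb, h⟩
      · exact absurd hb hv
      · exact Or.inr ⟨a, b, hab, ha, hb⟩
      · exact Or.inl ⟨a, Or.inr (hr hab), ha⟩
      · exact Or.inl ⟨b, Or.inr hab, hb⟩
      · exact absurd hab hvv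
    · rintro (⟨b, hb | hb, h⟩ | ⟨a, b, hab, ha, hb⟩)
      · exact Or.inl ⟨b, hb, Or.inl h⟩
      · exact Or.inr ⟨v, b, hb, Or.inr rfl, Or.inl h⟩
      · exact Or.inr ⟨a, b, hab, Or.inl ha, Or.inl hb⟩
  · convert h₂ using 1
    ext m
    have hm : m ∈ Set.Ici (Finsupp.single v 1) ↔ m v ≠ 0 := by
      rw [Set.mem_Ici, Finsupp.single_le_iff, Nat.one_le_iff_ne_zero]
    rw [Set.mem_union, hm]
    simp only [relExponents, Set.mem_ofPred_eq, Set.mem_insert_iff]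
    constructor
    · rintro ((⟨b, hb, h⟩ | h) | h)
      exacts [Or.inl ⟨b, Or.inr hb, h⟩, Or.inr h, Or.inl ⟨v, Or.inl rfl, h⟩]
    · rintro (⟨b, rfl | hb, h⟩ | h)
      exacts [Or.inr h, Or.inl (Or.inl ⟨b, hb, h⟩), Or.inl (Or.inr h)]

/-- Recursive branching on variables, controlled by an invariant of the set of variables set to
zero. -/
theorem regularOnExponents_of_invariant [Finite V] {rs : List (MvPolynomial V K)}
    {r : V → V → Prop} (hr : ∀ ⦃a b⦄, r a b → r b a) (I : Set V → Prop)
    (hcover : ∀ B, I B → RegularOnExponents rs {m | ∃ b ∈ B, m b ≠ 0})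
    (hstep : ∀ B, I B → ∀ a b, r a b → a ∉ B → b ∉ B →
      ∃ v w, v ∉ B ∧ w ∉ B ∧ r v w ∧ ¬ r v v ∧ I (B ∪ {w | r v w}) ∧ I (insert v B))
    {B : Set V} (hB : I B) : RegularOnExponents rs (relExponents r B) := by
  induction B using WellFoundedGT.induction with
  | ind B ih =>
    by_cases h : ∀ a b, r a b → a ∈ B ∨ b ∈ B
    · rw [relExponents_of_cover h]
      exact hcover B hB
    · push Not at h
      obtain ⟨a, b, hab, ha, hb⟩ := h
      obtain ⟨v, w, hv, hw, hvw, hvv, h₁, h₂⟩ := hstep B hB a b hab ha hb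
      refine regularOnExponents_branch hr hv hvv (ih _ ?_ h₁) (ih _ (Set.ssubset_insert hv) h₂)
      exact Set.ssubset_iff_exists.2 ⟨Set.subset_union_left, w, Or.inr hvw, hw⟩

/-- Disjointness of the stars forbids edges between centers, so every remaining edge has an end that
is not a center, and branching there keeps all stars live. -/
theorem regularOnExponents_stars [Finite V] {rs : List (MvPolynomial V K)} {ι : Type*}
    {r : V → V → Prop} (hr : ∀ ⦃a b⦄, r a b → r b a) (hirr : ∀ v, ¬ r v v) {c : ι → V} {S : ι → Set V}
    (hS : Pairwise fun i j => Disjoint (S i) (S j)) (hc : ∀ i, c i ∈ S i)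
    (hcS : ∀ i w, r (c i) w → w ∈ S i)
    (hcover : ∀ B : Set V, (∀ i, ∃ z ∈ S i, z ∉ B) →
      RegularOnExponents rs {m | ∃ b ∈ B, m b ≠ 0}) :
    RegularOnExponents rs (relExponents r ∅) := by
  refine regularOnExponents_of_invariant hr (fun B => ∀ i, IsLive r (c i) (S i) B)
    (fun B hB => hcover B fun i => (hB i).exists_notMem (hc i)) ?_ (fun i => Or.inl id)
  have key : ∀ B, (∀ i, IsLive r (c i) (S i) B) → ∀ v w, (∀ i, v ≠ c i) → r v w → v ∉ B → w ∉ B →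
      ∃ v w, v ∉ B ∧ w ∉ B ∧ r v w ∧ ¬ r v v ∧
        (∀ i, IsLive r (c i) (S i) (B ∪ {w | r v w})) ∧
        (∀ i, IsLive r (c i) (S i) (insert v B)) :=
    fun B hB v w hvc hvw hv hw => ⟨v, w, hv, hw, hvw, hirr v,
      fun i => (hB i).union_nbr hr (hcS i) hv (hirr v), fun i => (hB i).insert (hvc i) hvw hw⟩
  intro B hB a b hab ha hb
  by_cases hac : ∀ i, a ≠ c i
  · exact key B hB a b hac hab ha hb
  · push Not at hac
    obtain ⟨i, rfl⟩ := hac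
    refine key B hB b (c i) ?_ (hr hab) hb ha
    rintro j rfl
    by_cases hij : i = j
    · subst hij
      exact hirr _ hab
    · exact Set.disjoint_left.1 (hS hij) (hcS i _ hab) (hc j)

/-- Besides the stars in `T`, one of `x`, `y` must stay outside the final cover. Branching avoids
both until `xy` is the only edge left; meanwhile `hxyr` ensures that when one of them is swallowed
the other becomes free. -/
theorem regularOnExponents_stars_and_edge [Finite V] {rs : List (MvPolynomial V K)} {ι : Type*}
    {r : V → V → Prop} (hr : ∀ ⦃a b⦄, r a b → r b a) {c : ι → V} {S : ι → Set V} {T : Set ι} {x y : V}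
    {B : Set V} (hS : T.Pairwise fun i j => Disjoint (S i) (S j)) (hc : ∀ i, c i ∈ S i)
    (hcS : ∀ i ∈ T, ∀ w, r (c i) w → w ∈ S i) (hloop : ∀ a, r a a → a ∈ B)
    (hxy : r x y) (hxyr : ∀ a b, r x a → r y b → r a b) (hx : x ∉ B) (hy : y ∉ B)
    (hcB : ∀ i ∈ T, c i ∉ B) (hxc : ∀ i ∈ T, ¬ r x (c i)) (hyc : ∀ i ∈ T, ¬ r y (c i))
    (hcover : ∀ B : Set V, (x ∉ B ∨ y ∉ B) → (∀ i ∈ T, ∃ z ∈ S i, z ∉ B) →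
      RegularOnExponents rs {m | ∃ b ∈ B, m b ≠ 0}) :
    RegularOnExponents rs (relExponents r B) := by
  let I : Set V → Prop := fun B => (∀ a, r a a → a ∈ B) ∧ (∀ i ∈ T, IsLive r (c i) (S i) B) ∧
    ((x ∉ B ∧ y ∉ B) ∨ IsFree r B x ∨ IsFree r B y)
  refine regularOnExponents_of_invariant hr I ?_ ?_
    ⟨hloop, fun i hi => Or.inl (hcB i hi), Or.inl ⟨hx, hy⟩⟩
  · rintro B ⟨-, h, h'⟩
    refine hcover B ?_ fun i hi => (h i hi).exists_notMem (hc i)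
    rcases h' with h' | h' | h'
    exacts [Or.inl h'.1, Or.inl h'.1, Or.inr h'.1]
  have hxne : ∀ i ∈ T, x ≠ c i := fun i hi h => hyc i hi (h ▸ hr hxy)
  have hyne : ∀ i ∈ T, y ≠ c i := fun i hi h => hxc i hi (h ▸ hxy)
  have key : ∀ B, I B → ∀ v w, (∀ i ∈ T, v ≠ c i) → v ≠ x → v ≠ y → r v w → v ∉ B → w ∉ B →
      ∃ v w, v ∉ B ∧ w ∉ B ∧ r v w ∧ ¬ r v v ∧ I (B ∪ {w | r v w}) ∧ I (insert v B) := by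
    rintro B ⟨hl, hT, hxyB⟩ v w hvc hvx hvy hvw hv hw
    have hvv : ¬ r v v := fun h => hv (hl v h)
    refine ⟨v, w, hv, hw, hvw, hvv, ⟨fun a ha => Or.inl (hl a ha),
      fun i hi => (hT i hi).union_nbr hr (hcS i hi) hv hvv, ?_⟩, ⟨fun a ha => Or.inr (hl a ha),
      fun i hi => (hT i hi).insert (hvc i hi) hvw hw, ?_⟩⟩
    · rcases hxyB with ⟨hxB, hyB⟩ | h | h
      · by_cases hvx' : r v x
        -- Here `x` is swallowed. Since `v` is related to `x`, `hxyr` makes every neighbour of `y` a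
        -- neighbour of `v`, so `y` becomes free; it is not swallowed too, as that would put a loop
        -- at `v`.
        · refine Or.inr (Or.inr ⟨fun h => h.elim hyB fun h => ?_, fun w hw => Or.inr ?_⟩)
          · exact hvv (hxyr v v (hr hvx') (hr h))
          · exact hxyr v w (hr hvx') hw
        · by_cases hvy' : r v y
          · refine Or.inr (Or.inl ⟨fun h => h.elim hxB hvx', fun w hw => Or.inr ?_⟩)
            exact hr (hxyr w v hw (hr hvy'))
          · exact Or.inl ⟨fun h => h.elim hxB hvx', fun h => h.elim hyB hvy'⟩
      · exact Or.inr (Or.inl (h.union_nbr hr hv))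
      · exact Or.inr (Or.inr (h.union_nbr hr hv))
    · rcases hxyB with ⟨hxB, hyB⟩ | h | h
      · exact Or.inl ⟨fun h => h.elim (fun h => hvx h.symm) hxB,
          fun h => h.elim (fun h => hvy h.symm) hyB⟩
      · exact Or.inr (Or.inl (h.insert hvw hw))
      · exact Or.inr (Or.inr (h.insert hvw hw))
  intro B hB a b hab ha hb
  by_cases hother : ∃ a b, r a b ∧ a ∉ B ∧ b ∉ B ∧ ¬ (a = x ∧ b = y) ∧ ¬ (a = y ∧ b = x)
  · clear hab ha hb a b
    obtain ⟨a, b, hab, ha, hb, h₁, h₂⟩ := hother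
    have hne : a ≠ b := fun h => ha (hB.1 a (by rw [← h] at hab; exact hab))
    -- At least one end is allowed: centers in `T` are unrelated to each other and to `x`, `y`, and
    -- the edge is not `xy`.
    by_cases hav : (∀ i ∈ T, a ≠ c i) ∧ a ≠ x ∧ a ≠ y
    · exact key B hB a b hav.1 hav.2.1 hav.2.2 hab ha hb
    · have hbx : b = x → (∀ i ∈ T, a ≠ c i) ∧ a ≠ x ∧ a ≠ y := by
        rintro rfl
        exact ⟨fun i hi h => hxc i hi (h ▸ hr hab), hne, fun h => h₂ ⟨h, rfl⟩⟩
      have hby : b = y → (∀ i ∈ T, a ≠ c i) ∧ a ≠ x ∧ a ≠ y := by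
        rintro rfl
        exact ⟨fun i hi h => hyc i hi (h ▸ hr hab), fun h => h₁ ⟨h, rfl⟩, hne⟩
      have hbc : ∀ j ∈ T, b = c j → (∀ i ∈ T, a ≠ c i) ∧ a ≠ x ∧ a ≠ y := by
        rintro j hj rfl
        refine ⟨?_, fun h => hxc j hj (h ▸ hab), fun h => hyc j hj (h ▸ hab)⟩
        rintro i hi rfl
        exact Set.disjoint_left.1 (hS hi hj fun h => hne (h ▸ rfl)) (hcS i hi _ hab) (hc j)
      exact key B hB b a (fun j hj h => hav (hbc j hj h)) (fun h => hav (hbx h))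
        (fun h => hav (hby h)) (hr hab) hb ha
  · have honly : ∀ a b, r a b → a ∉ B → b ∉ B → (a = x ∧ b = y) ∨ (a = y ∧ b = x) :=
      fun a b hab ha hb => by_contra fun h =>
        hother ⟨a, b, hab, ha, hb, fun h₁ => h (Or.inl h₁), fun h₂ => h (Or.inr h₂)⟩
    obtain ⟨hxB, hyB⟩ : x ∉ B ∧ y ∉ B := by
      rcases honly a b hab ha hb with ⟨rfl, rfl⟩ | ⟨rfl, rfl⟩
      exacts [⟨ha, hb⟩, ⟨hb, ha⟩]
    have hxx : ¬ r x x := fun h => hxB (hB.1 x h)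
    -- Only `xy` is left: the colon by `x` makes `x` free, and setting `x` to zero makes `y` free.
    refine ⟨x, y, hxB, hyB, hxy, hxx, ⟨fun a ha => Or.inl (hB.1 a ha),
      fun i hi => (hB.2.1 i hi).union_nbr hr (hcS i hi) hxB hxx,
      Or.inr (Or.inl ⟨fun h => h.elim hxB hxx, fun w hw => Or.inr hw⟩)⟩,
      ⟨fun a ha => Or.inr (hB.1 a ha), fun i hi => (hB.2.1 i hi).insert (hxne i hi) hxy hyB,
      Or.inr (Or.inr ⟨fun h => h.elim (fun h => hxx (by rw [h] at hxy; exact hxy)) hyB,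
        fun w hw => ?_⟩)⟩⟩
    by_contra hwB
    rcases honly y w hw hyB fun h => hwB (Or.inr h) with h | h
    · exact hxx (by rw [h.1] at hxy; exact hxy)
    · exact hwB (Or.inl h.2)

end Branching

/-! ### Degrees of monomials on vertex covers. -/

section CoverDegree

variable {V : Type*}

/-- The degree of an exponent in the variables belonging to `C`. -/
noncomputable def degreeOn (C : Set V) : (V →₀ ℕ) →+ ℕ :=
  Finsupp.weight (C.indicator 1)

theorem degreeOn_single_of_mem {C : Set V} {v : V} (hv : v ∈ C) :
    degreeOn C (Finsupp.single v 1) = 1 := by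
  simp [degreeOn, Finsupp.weight_single, hv]

theorem degreeOn_single_of_notMem {C : Set V} {v : V} (hv : v ∉ C) :
    degreeOn C (Finsupp.single v 1) = 0 := by
  simp [degreeOn, Finsupp.weight_single, hv]

theorem degreeOn_eq_zero {C : Set V} {m : V →₀ ℕ} (h : ∀ v ∈ C, m v = 0) : degreeOn C m = 0 := by
  rw [degreeOn, Finsupp.weight_apply]
  refine Finset.sum_eq_zero fun v _ => ?_
  by_cases hv : v ∈ C <;> simp [hv, h]

theorem one_le_degreeOn {C : Set V} {m : V →₀ ℕ} {v : V} (hv : v ∈ C) (hm : m v ≠ 0) :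
    1 ≤ degreeOn C m := by
  have := Finsupp.le_weight_of_ne_zero' (C.indicator (1 : V → ℕ)) hm
  rwa [Set.indicator_of_mem hv] at this

theorem exists_of_one_le_degreeOn {C : Set V} {m : V →₀ ℕ} (h : 1 ≤ degreeOn C m) :
    ∃ v ∈ C, m v ≠ 0 := by
  by_contra! h'
  rw [degreeOn_eq_zero h'] at h
  exact absurd h (by norm_num)

theorem degreeOn_mono {C D : Set V} (h : C ⊆ D) (m : V →₀ ℕ) : degreeOn C m ≤ degreeOn D m := by
  classical
  rw [degreeOn, degreeOn, Finsupp.weight_apply, Finsupp.weight_apply]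
  refine Finset.sum_le_sum fun v _ => Nat.mul_le_mul_left _ ?_
  exact Set.indicator_le_indicator_of_subset h (fun _ => Nat.zero_le _) v

theorem isUpperSet_le_degreeOn (C : Set V) (k : ℕ) : IsUpperSet {m | k ≤ degreeOn C m} := by
  intro a b hab ha
  obtain ⟨c, rfl⟩ := exists_add_of_le hab
  simp only [Set.mem_ofPred_eq, map_add] at ha ⊢
  omega

theorem exists_single_add_single_le {C : Set V} {m : V →₀ ℕ} (h : 2 ≤ degreeOn C m) :
    ∃ a ∈ C, ∃ b ∈ C, Finsupp.single a 1 + Finsupp.single b 1 ≤ m := by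
  have hle : ∀ {m : V →₀ ℕ} {v}, m v ≠ 0 → Finsupp.single v 1 ≤ m := fun h =>
    Finsupp.single_le_iff.2 (Nat.one_le_iff_ne_zero.2 h)
  obtain ⟨a, ha, hma⟩ := exists_of_one_le_degreeOn (Nat.le_of_succ_le h)
  have hm := add_tsub_cancel_of_le (hle hma)
  have h1 : 1 ≤ degreeOn C (m - Finsupp.single a 1) := by
    rw [← hm, map_add, degreeOn_single_of_mem ha] at h
    omega
  obtain ⟨b, hb, hmb⟩ := exists_of_one_le_degreeOn h1
  refine ⟨a, ha, b, hb, ?_⟩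
  rw [← hm]
  exact add_le_add_right (hle hmb) _

/-- The exponents of degree at least two on every vertex cover. -/
def coverExponents (G : SimpleGraph V) : Set (V →₀ ℕ) :=
  {m | ∀ C : Set V, G.IsVertexCover C → 2 ≤ degreeOn C m}

theorem isUpperSet_coverExponents (G : SimpleGraph V) : IsUpperSet (coverExponents G) :=
  fun _ _ hab ha C hC => isUpperSet_le_degreeOn C 2 hab (ha C hC)

end CoverDegree

/-! ### Monomial description of the second symbolic power. -/

section SymbolicSquare

variable {K : Type*} [Field K] {V : Type*}

/-- The ideal generated by the variables in `C`, as a monomial ideal. -/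
noncomputable def varIdeal (K : Type*) [Field K] (C : Set V) : Ideal (MvPolynomial V K) :=
  restrictSupportIdeal K {m | 1 ≤ degreeOn C m} (isUpperSet_le_degreeOn C 1)

theorem le_weightedOrder_iff {C : Set V} {k : ℕ} {f : MvPolynomial V K} :
    (k : ℕ∞) ≤ (f : MvPowerSeries V K).weightedOrder (C.indicator 1) ↔
      ∀ m ∈ f.support, k ≤ degreeOn C m := by
  constructor
  · intro h m hm
    by_contra! h'
    rw [mem_support_iff, ← coeff_coe] at hm
    exact hm (MvPowerSeries.coeff_eq_zero_of_lt_weightedOrder _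
      (lt_of_lt_of_le (Nat.cast_lt.2 h') h))
  · intro h
    refine MvPowerSeries.nat_le_weightedOrder _ fun m hm => ?_
    rw [coeff_coe]
    by_contra h'
    exact absurd (h m (mem_support_iff.2 h')) (not_le.2 hm)

theorem mem_restrictSupportIdeal_degreeOn {C : Set V} {k : ℕ} {f : MvPolynomial V K} :
    f ∈ restrictSupportIdeal K {m | k ≤ degreeOn C m} (isUpperSet_le_degreeOn C k) ↔
      (k : ℕ∞) ≤ (f : MvPowerSeries V K).weightedOrder (C.indicator 1) :=
  le_weightedOrder_iff.symm

theorem mem_varIdeal {C : Set V} {f : MvPolynomial V K} :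
    f ∈ varIdeal K C ↔ 1 ≤ (f : MvPowerSeries V K).weightedOrder (C.indicator 1) := by
  rw [← Nat.cast_one, le_weightedOrder_iff]
  rfl

theorem X_mem_varIdeal {C : Set V} {v : V} : (X v : MvPolynomial V K) ∈ varIdeal K C ↔ v ∈ C := by
  simp only [varIdeal, mem_restrictSupportIdeal, support_X, Finset.mem_singleton, forall_eq,
    Set.mem_ofPred_eq]
  by_cases hv : v ∈ C
  · simp [degreeOn_single_of_mem hv, hv]
  · simp [degreeOn_single_of_notMem hv, hv]

theorem varIdeal_le {C : Set V} {J : Ideal (MvPolynomial V K)} (h : ∀ v ∈ C, X v ∈ J) :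
    varIdeal K C ≤ J := by
  have : varIdeal K C = Ideal.span (X '' C) := by
    ext f
    rw [mem_ideal_span_X_image]
    exact forall₂_congr fun m _ => ⟨exists_of_one_le_degreeOn, fun ⟨v, hv, hm⟩ =>
      one_le_degreeOn hv hm⟩
  rw [this, Ideal.span_le]
  rintro _ ⟨v, hv, rfl⟩
  exact h v hv

instance isPrime_varIdeal (C : Set V) : (varIdeal K C).IsPrime := by
  refine ⟨?_, ?_⟩
  · rw [Ideal.ne_top_iff_one, mem_varIdeal, coe_one, MvPowerSeries.weightedOrder_one]
    simp
  · intro f g h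
    simp only [mem_varIdeal, coe_mul, MvPowerSeries.weightedOrder_mul,
      Order.one_le_iff_ne_zero] at h ⊢
    by_contra! h'
    exact h (by rw [h'.1, h'.2, add_zero])

theorem edgeIdeal_le_varIdeal {G : SimpleGraph V} {C : Set V} (hC : G.IsVertexCover C) :
    edgeIdeal K G ≤ varIdeal K C := by
  refine Ideal.span_le.2 ?_
  rintro _ ⟨x, y, hxy, rfl⟩
  rcases hC hxy with h | h
  · exact Ideal.mul_mem_right _ _ (X_mem_varIdeal.2 h)
  · exact Ideal.mul_mem_left _ _ (X_mem_varIdeal.2 h)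

theorem isVertexCover_of_edgeIdeal_le {G : SimpleGraph V} {p : Ideal (MvPolynomial V K)}
    [hp : p.IsPrime] (h : edgeIdeal K G ≤ p) : G.IsVertexCover {v | X v ∈ p} :=
  fun x y hxy => hp.mem_or_mem (h (Ideal.subset_span ⟨x, y, hxy, rfl⟩))

theorem eq_varIdeal_of_mem_minimalPrimes {G : SimpleGraph V} {p : Ideal (MvPolynomial V K)}
    (hp : p ∈ (edgeIdeal K G).minimalPrimes) : p = varIdeal K {v | X v ∈ p} := by
  have := hp.1.1
  have hle : varIdeal K {v | X v ∈ p} ≤ p := varIdeal_le fun v hv => hv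
  exact le_antisymm (hp.2 ⟨inferInstance,
    edgeIdeal_le_varIdeal (isVertexCover_of_edgeIdeal_le hp.1.2)⟩ hle) hle

theorem mem_symbolicPower {R : Type*} [CommRing R] {I : Ideal R} {s : ℕ} {f : R} :
    f ∈ symbolicPower I s ↔ ∀ p ∈ I.minimalPrimes, ∃ t ∉ p, t * f ∈ I ^ s := by
  simp only [symbolicPower, Submodule.mem_iInf]
  refine forall₂_congr fun p hp => ?_
  have : p.IsPrime := hp.1.1
  rw [LinearMap.mem_ker, LinearMap.comp_apply, IsLocalizedModule.eq_zero_iff p.primeCompl]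
  constructor
  · rintro ⟨t, ht⟩
    refine ⟨t, t.2, ?_⟩
    rw [Submonoid.smul_def, ← map_smul, Submodule.mkQ_apply, Submodule.Quotient.mk_eq_zero] at ht
    exact ht
  · rintro ⟨t, ht, h⟩
    refine ⟨⟨t, ht⟩, ?_⟩
    rw [Submonoid.smul_def, ← map_smul, Submodule.mkQ_apply, Submodule.Quotient.mk_eq_zero]
    exact h

/-- Every cover contains a cover `D` whose variables generate a minimal prime. The order in the
variables of `D` is additive on products and zero on `t ∉ p`, so multiplying by `t` does not affect
having order at least 2. -/
theorem symbolicPower_le_restrictSupportIdeal (G : SimpleGraph V) :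
    symbolicPower (edgeIdeal K G) 2 ≤
      restrictSupportIdeal K (coverExponents G) (isUpperSet_coverExponents G) := by
  intro f hf m hm C hC
  obtain ⟨p, hp, hpC⟩ := Ideal.exists_minimalPrimes_le (edgeIdeal_le_varIdeal (K := K) hC)
  have := hp.1.1
  set D : Set V := {v | X v ∈ p} with hD
  have hpD : p = varIdeal K D := eq_varIdeal_of_mem_minimalPrimes hp
  have hDC : D ⊆ C := fun v hv => X_mem_varIdeal.1 (hpC hv)
  obtain ⟨t, ht, htf⟩ := mem_symbolicPower.1 hf p hp
  refine le_trans ?_ (degreeOn_mono hDC m)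
  have ht0 : (t : MvPowerSeries V K).weightedOrder (D.indicator 1) = 0 := by
    rw [hpD, mem_varIdeal, Order.one_le_iff_ne_zero, not_not] at ht
    exact ht
  have h2 : (edgeIdeal K G) ^ 2 ≤
      restrictSupportIdeal K {m | 2 ≤ degreeOn D m} (isUpperSet_le_degreeOn D 2) := by
    rw [sq, Ideal.mul_le]
    intro a ha b hb
    have ha' := mem_varIdeal.1 (hpD ▸ hp.1.2 ha)
    have hb' := mem_varIdeal.1 (hpD ▸ hp.1.2 hb)
    rw [mem_restrictSupportIdeal_degreeOn, coe_mul, MvPowerSeries.weightedOrder_mul]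
    exact (by norm_num : ((2 : ℕ) : ℕ∞) = 1 + 1) ▸ add_le_add ha' hb'
  have h3 := mem_restrictSupportIdeal_degreeOn.1 (h2 htf)
  rw [coe_mul, MvPowerSeries.weightedOrder_mul, ht0, zero_add] at h3
  exact le_weightedOrder_iff.1 h3 m hm

/-- By minimality each vertex of `D` has a neighbour outside `D`. For a monomial divisible by `ab`
with `a, b ∈ D`, such neighbours `a'`, `b'` give the multiplier `a'b'`, as `(aa')(bb')` lies in the
square. -/
theorem restrictSupportIdeal_le_symbolicPower (G : SimpleGraph V) :
    restrictSupportIdeal K (coverExponents G) (isUpperSet_coverExponents G) ≤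
      symbolicPower (edgeIdeal K G) 2 := by
  intro f hf
  rw [← f.support_sum_monomial_coeff]
  refine Ideal.sum_mem _ fun m hm => mem_symbolicPower.2 fun p hp => ?_
  have := hp.1.1
  set D : Set V := {v | X v ∈ p} with hD
  have hpD : p = varIdeal K D := eq_varIdeal_of_mem_minimalPrimes hp
  have hcov : G.IsVertexCover D := isVertexCover_of_edgeIdeal_le hp.1.2
  have hnbr : ∀ x ∈ D, ∃ y, (X y : MvPolynomial V K) ∉ p ∧ G.Adj x y := by
    intro x hx
    by_contra! h
    have hcov' : G.IsVertexCover (D \ {x}) := by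
      intro a b hab
      by_cases hax : a = x
      · subst hax
        refine Or.inr ⟨by_contra fun hb => h b hb hab, hab.ne'⟩
      · by_cases hbx : b = x
        · subst hbx
          exact Or.inl ⟨by_contra fun ha => h a ha hab.symm, hax⟩
        · exact (hcov hab).imp (fun h => ⟨h, hax⟩) (fun h => ⟨h, hbx⟩)
    have hle : varIdeal K (D \ {x}) ≤ p := varIdeal_le fun v hv => hv.1
    have := hp.2 ⟨inferInstance, edgeIdeal_le_varIdeal hcov'⟩ hle hx
    exact (X_mem_varIdeal.1 this).2 rfl
  obtain ⟨a, ha, b, hb, hab⟩ := exists_single_add_single_le (hf hm D hcov)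
  obtain ⟨a', ha', haa⟩ := hnbr a ha
  obtain ⟨b', hb', hbb⟩ := hnbr b hb
  refine ⟨X a' * X b', fun h => (hp.1.1.mem_or_mem h).elim ha' hb', ?_⟩
  have hm' : monomial m (coeff m f) = monomial (m - (Finsupp.single a 1 + Finsupp.single b 1))
      (coeff m f) * (X a * X b) := by
    rw [X, X, monomial_mul, monomial_mul, mul_one, mul_one, tsub_add_cancel_of_le hab]
  have hmem : (X a * X a') * (X b * X b') ∈ edgeIdeal K G ^ 2 := by
    rw [sq]
    exact Ideal.mul_mem_mul (Ideal.subset_span ⟨a, a', haa, rfl⟩)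
      (Ideal.subset_span ⟨b, b', hbb, rfl⟩)
  have := Ideal.mul_mem_left _
    (monomial (m - (Finsupp.single a 1 + Finsupp.single b 1)) (coeff m f)) hmem
  rw [hm']
  convert this using 1
  ring

theorem symbolicPower_edgeIdeal_two (G : SimpleGraph V) :
    symbolicPower (edgeIdeal K G) 2 =
      restrictSupportIdeal K (coverExponents G) (isUpperSet_coverExponents G) :=
  le_antisymm (symbolicPower_le_restrictSupportIdeal G) (restrictSupportIdeal_le_symbolicPower G)

end SymbolicSquare

/-! ### Colons by an edge. -/

section ColonByEdge

variable {V : Type*} {G : SimpleGraph V}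

/-- Two vertices are related when they are adjacent in `G`, or when one is a neighbour of `x` and
the other is a neighbour of `y`. -/
def edgeRel (G : SimpleGraph V) (x y a b : V) : Prop :=
  G.Adj a b ∨ (G.Adj x a ∧ G.Adj y b) ∨ (G.Adj y a ∧ G.Adj x b)

theorem edgeRel_symm {x y : V} ⦃a b : V⦄ (h : edgeRel G x y a b) : edgeRel G x y b a := by
  rcases h with h | ⟨h₁, h₂⟩ | ⟨h₁, h₂⟩
  exacts [Or.inl h.symm, Or.inr (Or.inr ⟨h₂, h₁⟩), Or.inr (Or.inl ⟨h₂, h₁⟩)]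

theorem edgeRel_left {x y a : V} : edgeRel G x y x a ↔ G.Adj x a := by
  refine ⟨fun h => ?_, Or.inl⟩
  rcases h with h | ⟨h₁, h₂⟩ | ⟨h₁, h₂⟩
  exacts [h, absurd h₁ G.irrefl, h₂]

theorem edgeRel_right {x y a : V} : edgeRel G x y y a ↔ G.Adj y a := by
  refine ⟨fun h => ?_, Or.inl⟩
  rcases h with h | ⟨h₁, h₂⟩ | ⟨h₁, h₂⟩
  exacts [h, h₂, absurd h₁ G.irrefl]

/-- If `m` is not in the right-hand side, its support is independent and misses `N(x)` or `N(y)`.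
When it misses `N(x)`, the complement of the support with `x` removed is a cover on which `m + x +
y` has degree 1, coming from `y` alone. -/
theorem add_mem_coverExponents_iff {x y : V} (hxy : G.Adj x y) (m : V →₀ ℕ) :
    m + (Finsupp.single x 1 + Finsupp.single y 1) ∈ coverExponents G ↔
      m ∈ relExponents (edgeRel G x y) ∅ := by
  have notMem : ∀ x y, G.Adj x y → (∀ a b, G.Adj a b → m a ≠ 0 → m b = 0) →
      (∀ a, G.Adj x a → m a = 0) →
      m + (Finsupp.single x 1 + Finsupp.single y 1) ∉ coverExponents G := by
    intro x y hxy hind hx h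
    have h2 := h {v | m v = 0 ∧ v ≠ x} ?_
    · have hxC : x ∉ {v | m v = 0 ∧ v ≠ x} := fun h => h.2 rfl
      have hyC : y ∈ {v | m v = 0 ∧ v ≠ x} := ⟨hx y hxy, hxy.ne'⟩
      rw [map_add, map_add, degreeOn_eq_zero (fun v hv => hv.1),
        degreeOn_single_of_notMem hxC,
        degreeOn_single_of_mem hyC] at h2
      omega
    · intro a b hab
      by_cases hax : a = x
      · subst hax
        exact Or.inr ⟨hx b hab, hab.ne'⟩
      · by_cases hbx : b = x
        · subst hbx
          exact Or.inl ⟨hx a hab.symm, hax⟩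
        · by_cases ha : m a = 0
          · exact Or.inl ⟨ha, hax⟩
          · exact Or.inr ⟨hind a b hab ha, hbx⟩
  constructor
  · intro h
    by_contra hm
    have hrel : ∀ a b, edgeRel G x y a b → m a ≠ 0 → m b = 0 := fun a b hab ha =>
      by_contra fun hb => hm (Or.inr ⟨a, b, hab, ha, hb⟩)
    have hind : ∀ a b, G.Adj a b → m a ≠ 0 → m b = 0 := fun a b hab => hrel a b (Or.inl hab)
    by_cases hx : ∀ a, G.Adj x a → m a = 0
    · exact notMem x y hxy hind hx h
    · push Not at hx
      obtain ⟨a, hxa, ha⟩ := hx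
      refine notMem y x hxy.symm hind (fun b hyb => hrel a b (Or.inr (Or.inl ⟨hxa, hyb⟩)) ha) ?_
      rwa [add_comm (Finsupp.single y 1)]
  · rintro (⟨_, h, -⟩ | ⟨a, b, hab, ha, hb⟩) C hC
    · exact absurd h id
    rw [map_add, map_add]
    by_cases hx : x ∈ C
    · rw [degreeOn_single_of_mem hx]
      by_cases hy : y ∈ C
      · rw [degreeOn_single_of_mem hy]
        omega
      · have hy' : ∀ v, G.Adj y v → v ∈ C := fun v hv => (hC hv).resolve_left hy
        have : 1 ≤ degreeOn C m := by
          rcases hab with h | ⟨-, h⟩ | ⟨h, -⟩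
          · exact (hC h).elim (fun h => one_le_degreeOn h ha) fun h => one_le_degreeOn h hb
          · exact one_le_degreeOn (hy' _ h) hb
          · exact one_le_degreeOn (hy' _ h) ha
        omega
    · have hx' : ∀ v, G.Adj x v → v ∈ C := fun v hv => (hC hv).resolve_left hx
      rw [degreeOn_single_of_mem (hx' y hxy)]
      have : 1 ≤ degreeOn C m := by
        rcases hab with h | ⟨h, -⟩ | ⟨-, h⟩
        · exact (hC h).elim (fun h => one_le_degreeOn h ha) fun h => one_le_degreeOn h hb
        · exact one_le_degreeOn (hx' _ h) ha
        · exact one_le_degreeOn (hx' _ h) hb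
      omega

/-- The exponents in `coverExponents G` together with those of multiples of the edges in `E`. -/
def edgeExponents (G : SimpleGraph V) (E : Set (V × V)) : Set (V →₀ ℕ) :=
  coverExponents G ∪ {m | ∃ e ∈ E, m e.1 ≠ 0 ∧ m e.2 ≠ 0}

theorem isUpperSet_edgeExponents (E : Set (V × V)) : IsUpperSet (edgeExponents G E) := by
  refine (isUpperSet_coverExponents G).union ?_
  rintro a b hab ⟨e, he, h₁, h₂⟩
  have hle : ∀ v, a v ≤ b v := hab
  refine ⟨e, he, ?_, ?_⟩
  · have := hle e.1; omega
  · have := hle e.2; omega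

/-- If the support of `m` is independent, its complement is a vertex cover on which `m` has degree
0. -/
theorem edgeExponents_adj : edgeExponents G {e | G.Adj e.1 e.2} = relExponents G.Adj ∅ := by
  ext m
  constructor
  · rintro (h | ⟨e, he, h₁, h₂⟩)
    · by_contra hm
      have hcov : G.IsVertexCover {v | m v = 0} := by
        intro a b hab
        by_contra! h'
        exact hm (Or.inr ⟨a, b, hab, h'.1, h'.2⟩)
      have h0 : degreeOn {v | m v = 0} m = 0 := degreeOn_eq_zero fun v hv => hv
      exact absurd (h _ hcov) (by rw [h0]; norm_num)
    · exact Or.inr ⟨e.1, e.2, he, h₁, h₂⟩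
  · rintro (⟨_, h, -⟩ | ⟨a, b, hab, ha, hb⟩)
    exacts [absurd h id, Or.inr ⟨(a, b), hab, ha, hb⟩]

theorem edgeExponents_insert (E : Set (V × V)) {x y : V} (hxy : x ≠ y) :
    edgeExponents G (insert (x, y) E) =
      edgeExponents G E ∪ Set.Ici (Finsupp.single x 1 + Finsupp.single y 1) := by
  classical
  ext m
  have hm : m ∈ Set.Ici (Finsupp.single x 1 + Finsupp.single y 1) ↔ m x ≠ 0 ∧ m y ≠ 0 := by
    rw [Set.mem_Ici, Finsupp.le_def]
    constructor
    · intro h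
      have hx := h x
      have hy := h y
      rw [Finsupp.add_apply, Finsupp.single_eq_same] at hx
      rw [Finsupp.add_apply, Finsupp.single_eq_same] at hy
      omega
    · rintro ⟨hx, hy⟩ v
      rw [Finsupp.add_apply, Finsupp.single_apply, Finsupp.single_apply]
      split_ifs with h₁ h₂ h₂
      · exact absurd (h₁.trans h₂.symm) hxy
      · subst h₁; omega
      · subst h₂; omega
      · omega
  rw [Set.mem_union, hm]
  simp only [edgeExponents, Set.mem_union, Set.mem_ofPred_eq, Set.exists_mem_insert]
  rw [or_assoc, or_comm (a := m x ≠ 0 ∧ m y ≠ 0)]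

variable {E : Set (V × V)} {x y : V}

theorem mem_of_mem_edgeExponents (hxy : G.Adj x y)
    (he : Finsupp.single x 1 + Finsupp.single y 1 ∉ edgeExponents G E) {m : V →₀ ℕ}
    (hm : m + (Finsupp.single x 1 + Finsupp.single y 1) ∈ edgeExponents G E) :
    m ∈ relExponents (edgeRel G x y) ∅ ∨ ∃ e ∈ E, (m e.1 ≠ 0 ∧ m e.2 ≠ 0) ∨
      (m e.1 ≠ 0 ∧ (e.2 = x ∨ e.2 = y)) ∨ ((e.1 = x ∨ e.1 = y) ∧ m e.2 ≠ 0) := by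
  classical
  have hs : ∀ v, (m + (Finsupp.single x 1 + Finsupp.single y 1) : V →₀ ℕ) v ≠ 0 →
      m v ≠ 0 ∨ v = x ∨ v = y := by
    intro v hv
    by_contra! h
    simp [h.1, h.2.1.symm, h.2.2.symm] at hv
  rcases hm with hm | ⟨e, heE, h₁, h₂⟩
  · exact Or.inl ((add_mem_coverExponents_iff hxy m).1 hm)
  · refine Or.inr ⟨e, heE, ?_⟩
    rcases hs _ h₁ with h₁ | h₁
    · rcases hs _ h₂ with h₂ | h₂
      exacts [Or.inl ⟨h₁, h₂⟩, Or.inr (Or.inl ⟨h₁, h₂⟩)]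
    · rcases hs _ h₂ with h₂ | h₂
      · exact Or.inr (Or.inr ⟨h₁, h₂⟩)
      · refine absurd (Or.inr ⟨e, heE, ?_, ?_⟩) he
        · rcases h₁ with h | h <;> simp [h]
        · rcases h₂ with h | h <;> simp [h]

/-- An edge of `E` meeting `xy` in one vertex contributes its other end as a variable; one disjoint
from `xy` is already in `edgeRel`. -/
theorem colon_edgeExponents (hE : ∀ e ∈ E, G.Adj e.1 e.2) (hxy : G.Adj x y)
    (he : Finsupp.single x 1 + Finsupp.single y 1 ∉ edgeExponents G E) :
    {m | m + (Finsupp.single x 1 + Finsupp.single y 1) ∈ edgeExponents G E} =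
      relExponents (edgeRel G x y)
        {a | Finsupp.single a 1 + (Finsupp.single x 1 + Finsupp.single y 1) ∈
          edgeExponents G E} := by
  classical
  ext m
  constructor
  · intro hm
    rcases mem_of_mem_edgeExponents hxy he hm with h | ⟨e, heE, h | ⟨h, h'⟩ | ⟨h', h⟩⟩
    · rcases h with ⟨_, h, -⟩ | h
      exacts [absurd h id, Or.inr h]
    · exact Or.inr ⟨e.1, e.2, Or.inl (hE e heE), h⟩
    · refine Or.inl ⟨e.1, Or.inr ⟨e, heE, by simp, ?_⟩, h⟩
      rcases h' with h' | h' <;> simp [h']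
    · refine Or.inl ⟨e.2, Or.inr ⟨e, heE, ?_, by simp⟩, h⟩
      rcases h' with h' | h' <;> simp [h']
  · rintro (⟨b, hb, hmb⟩ | h)
    · refine isUpperSet_edgeExponents E (add_le_add_left ?_ _) hb
      exact Finsupp.single_le_iff.2 (Nat.one_le_iff_ne_zero.2 hmb)
    · exact Or.inl ((add_mem_coverExponents_iff hxy m).2 (Or.inr h))

/-- This keeps `x`, `y` and the centers of stars avoiding both out of the set of variables produced
by the colon. -/
theorem adj_of_single_add_mem (hE : ∀ e ∈ E, G.Adj e.1 e.2) (hxy : G.Adj x y)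
    (he : Finsupp.single x 1 + Finsupp.single y 1 ∉ edgeExponents G E) {a : V}
    (ha : Finsupp.single a 1 + (Finsupp.single x 1 + Finsupp.single y 1) ∈ edgeExponents G E) :
    a ≠ x ∧ a ≠ y ∧ (G.Adj x a ∨ G.Adj y a) := by
  classical
  have hs : ∀ v, (Finsupp.single a 1 : V →₀ ℕ) v ≠ 0 → v = a := by
    intro v hv
    by_contra h
    exact hv (Finsupp.single_eq_of_ne h)
  have main : (G.Adj x a ∧ G.Adj y a) ∨
      ∃ e ∈ E, (e.1 = a ∧ (e.2 = x ∨ e.2 = y)) ∨ ((e.1 = x ∨ e.1 = y) ∧ e.2 = a) := by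
    rcases mem_of_mem_edgeExponents hxy he ha with h | ⟨e, heE, h | ⟨h, h'⟩ | ⟨h', h⟩⟩
    · rcases h with ⟨_, h, -⟩ | ⟨b, c, hbc, hb, hc⟩
      · exact absurd h id
      · rw [hs b hb, hs c hc] at hbc
        rcases hbc with h | h | h
        exacts [absurd h G.irrefl, Or.inl h, Or.inl h.symm]
    · have := hE e heE
      rw [hs _ h.1, hs _ h.2] at this
      exact absurd this G.irrefl
    · exact Or.inr ⟨e, heE, Or.inl ⟨hs _ h, h'⟩⟩
    · exact Or.inr ⟨e, heE, Or.inr ⟨h', hs _ h⟩⟩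
  have hadj : G.Adj x a ∨ G.Adj y a := by
    rcases main with h | ⟨e, heE, ⟨h, h' | h'⟩ | ⟨h' | h', h⟩⟩
    · exact Or.inl h.1
    all_goals
      have := hE e heE
      rw [h, h'] at this
    exacts [Or.inl this.symm, Or.inr this.symm, Or.inl this, Or.inr this]
  have hnot : ∀ e ∈ E, ¬ ((e.1 = x ∨ e.1 = y) ∧ (e.2 = x ∨ e.2 = y)) := by
    rintro e heE ⟨h₁, h₂⟩
    refine he (Or.inr ⟨e, heE, ?_, ?_⟩)
    · rcases h₁ with h | h <;> simp [h]
    · rcases h₂ with h | h <;> simp [h]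
  have hne : ∀ z, (z = x ∨ z = y) → a ≠ z := by
    rintro z hz rfl
    rcases main with h | ⟨e, heE, ⟨h, h'⟩ | ⟨h', h⟩⟩
    · rcases hz with rfl | rfl
      exacts [G.irrefl h.1, G.irrefl h.2]
    · exact hnot e heE ⟨h ▸ hz, h'⟩
    · exact hnot e heE ⟨h', h ▸ hz⟩
  exact ⟨hne x (Or.inl rfl), hne y (Or.inr rfl), hadj⟩

end ColonByEdge

/-! ### Assembling the regular sequence. -/

/-- The closed neighbourhood of a vertex. -/
def closedNbhd {V : Type*} (G : SimpleGraph V) (v : V) : Set V := insert v (G.neighborSet v)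

section Main

variable {K : Type*} [Field K] {V : Type*} [Fintype V] {G : SimpleGraph V}

variable {n : ℕ} {c : Fin (n + 1) → V}

/-- The set `E` interpolates between the symbolic square (`E = ∅`) and the edge ideal (all edges),
and the induction runs downwards from the latter. -/
theorem regularOnExponents_edgeExponents
    (hc : Pairwise fun i j => Disjoint (closedNbhd G (c i)) (closedNbhd G (c j)))
    {E : Set (V × V)} (hE : ∀ e ∈ E, G.Adj e.1 e.2) :
    RegularOnExponents (sumForms K fun i => closedNbhd G (c i)) (edgeExponents G E) := by
  classical
  have : Nonempty V := ⟨c 0⟩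
  have huniq : ∀ {i j v}, v ∈ closedNbhd G (c i) → v ∈ closedNbhd G (c j) → i = j :=
    fun hi hj => by_contra fun h => Set.disjoint_left.1 (hc h) hi hj
  induction E using WellFoundedGT.induction with
  | ind E ih =>
    by_cases hall : ∀ x y, G.Adj x y → (x, y) ∈ E
    · have : E = {e | G.Adj e.1 e.2} := Set.ext fun e => ⟨hE e, hall e.1 e.2⟩
      rw [this, edgeExponents_adj]
      refine regularOnExponents_stars (fun _ _ h => h.symm) (fun v => G.irrefl) hc
        (fun i => Or.inl rfl) (fun i w hw => Or.inr hw) fun B hB => ?_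
      -- Every star survives, so the exceptional index is arbitrary.
      exact regularOnExponents_cover hc (i₀ := 0) fun i _ => hB i
    push Not at hall
    obtain ⟨x, y, hxy, hxyE⟩ := hall
    have hE' : ∀ e ∈ insert (x, y) E, G.Adj e.1 e.2 := by
      rintro e (rfl | he)
      exacts [hxy, hE e he]
    have hins := ih _ (Set.ssubset_insert hxyE) hE'
    rw [edgeExponents_insert E hxy.ne] at hins
    refine .of_colon (Finsupp.single x 1 + Finsupp.single y 1) ?_ hins
    by_cases he : Finsupp.single x 1 + Finsupp.single y 1 ∈ edgeExponents G E
    -- The edge already lies in the ideal, so the colon is the unit ideal.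
    · exact regularOnExponents_of_zero_mem _ (by simpa using he)
    rw [colon_edgeExponents hE hxy he]
    have hB := fun a => adj_of_single_add_mem (a := a) hE hxy he
    have hnadj : ∀ i, x ∉ closedNbhd G (c i) ∧ y ∉ closedNbhd G (c i) →
        ¬ G.Adj x (c i) ∧ ¬ G.Adj y (c i) :=
      fun i hi => ⟨fun h => hi.1 (Or.inr h.symm), fun h => hi.2 (Or.inr h.symm)⟩
    refine regularOnExponents_stars_and_edge (c := c) (S := fun i => closedNbhd G (c i))
      (T := {i | x ∉ closedNbhd G (c i) ∧ y ∉ closedNbhd G (c i)}) edgeRel_symm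
      (hc.set_pairwise _) (fun i => Or.inl rfl) ?_ ?_ (Or.inl hxy) ?_
      (fun h => (hB x h).1 rfl) (fun h => (hB y h).2.1 rfl) ?_ ?_ ?_ ?_
    · rintro i hi w (h | ⟨h, -⟩ | ⟨h, -⟩)
      exacts [Or.inr h, absurd h (hnadj i hi).1, absurd h (hnadj i hi).2]
    · intro a ha
      -- A loop of `edgeRel` sits at a common neighbour `a` of `x` and `y`, and then `a` times `xy`
      -- is in the symbolic square.
      exact Or.inl ((add_mem_coverExponents_iff hxy _).2 (Or.inr ⟨a, a, ha, by simp, by simp⟩))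
    · intro a b ha hb
      exact Or.inr (Or.inl ⟨edgeRel_left.1 ha, edgeRel_right.1 hb⟩)
    · intro i hi h
      exact (hB _ h).2.2.elim (hnadj i hi).1 (hnadj i hi).2
    · exact fun i hi h => (hnadj i hi).1 (edgeRel_left.1 h)
    · exact fun i hi h => (hnadj i hi).2 (edgeRel_right.1 h)
    · have hcover : ∀ x y, ∀ B : Set V, x ∉ B →
          (∀ i, x ∉ closedNbhd G (c i) ∧ y ∉ closedNbhd G (c i) →
            ∃ z ∈ closedNbhd G (c i), z ∉ B) →
          RegularOnExponents (sumForms K fun i => closedNbhd G (c i))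
            {m : V →₀ ℕ | ∃ b ∈ B, m b ≠ 0} := by
        intro x y B hx hB
        -- The surviving vertex `x` saves any star containing it; only the star through `y`, if
        -- there is one, may be lost.
        obtain ⟨i₀, hi₀⟩ : ∃ i₀, ∀ i ≠ i₀, y ∉ closedNbhd G (c i) := by
          by_cases h : ∃ i, y ∈ closedNbhd G (c i)
          · obtain ⟨i₀, h₀⟩ := h
            exact ⟨i₀, fun i hi h => hi (huniq h h₀)⟩
          · exact ⟨0, fun i _ hi => h ⟨i, hi⟩⟩
        refine regularOnExponents_cover hc (i₀ := i₀) fun i hi => ?_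
        by_cases hxi : x ∈ closedNbhd G (c i)
        · exact ⟨x, hxi, hx⟩
        · exact hB i ⟨hxi, hi₀ i hi⟩
      rintro B (h | h) hB
      · exact hcover x y B h hB
      · exact hcover y x B h fun i hi => hB i ⟨hi.2, hi.1⟩

theorem isRegular_sumForms
    (hc : Pairwise fun i j => Disjoint (closedNbhd G (c i)) (closedNbhd G (c j))) :
    (∀ r ∈ sumForms K fun i => closedNbhd G (c i), r ∈ idealOfVars V K) ∧
    RingTheory.Sequence.IsRegular (MvPolynomial V K ⧸ symbolicPower (edgeIdeal K G) 2)
      (sumForms K fun i => closedNbhd G (c i)) := by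
  have hmem : ∀ r ∈ sumForms K fun i => closedNbhd G (c i), r ∈ idealOfVars V K := by
    intro r hr
    obtain ⟨i, -, rfl⟩ := List.mem_map.1 hr
    rw [linForm, Fintype.linearCombination_apply]
    refine Ideal.sum_mem _ fun v _ => ?_
    rw [smul_eq_C_mul]
    exact Ideal.mul_mem_left _ _ (Ideal.subset_span ⟨v, rfl⟩)
  refine ⟨hmem, ⟨?_, ?_⟩⟩
  · apply WeaklyRegularMod.isWeaklyRegular
    have h := regularOnExponents_edgeExponents (K := K) hc (E := ∅) (by simp)
    have he : edgeExponents G ∅ = coverExponents G := by simp [edgeExponents]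
    rw [he] at h
    rw [symbolicPower_edgeIdeal_two]
    exact h _
  · intro htop
    -- The quotient is nonzero because both the forms and the symbolic square lie in the ideal of
    -- all variables.
    have hle : Ideal.ofList (sumForms K fun i => closedNbhd G (c i)) ≤ varIdeal K Set.univ :=
      Ideal.span_le.2 fun r hr =>
        (Ideal.span_le.2 (by rintro _ ⟨v, rfl⟩; exact X_mem_varIdeal.2 trivial) :
          idealOfVars V K ≤ varIdeal K Set.univ) (hmem r hr)
    have hJ : symbolicPower (edgeIdeal K G) 2 ≤ varIdeal K Set.univ := by
      rw [symbolicPower_edgeIdeal_two]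
      exact fun f hf m hm => Nat.le_of_succ_le (hf hm Set.univ fun _ _ _ => Or.inl trivial)
    have h1 : Submodule.mkQ (symbolicPower (edgeIdeal K G) 2) 1 ∈
        (⊤ : Submodule (MvPolynomial V K) (MvPolynomial V K ⧸ symbolicPower (edgeIdeal K G) 2)) :=
      trivial
    rw [htop, ← Submodule.range_mkQ, ← Submodule.map_top, ← Submodule.map_smul'',
      ← Submodule.mem_comap, Submodule.comap_map_mkQ, smul_eq_mul, Ideal.mul_top] at h1
    exact (Ideal.ne_top_iff_one _).1 (isPrime_varIdeal (K := K) Set.univ).ne_top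
      (sup_le hJ hle h1)

end Main

theorem theorem4p2 {K : Type*} [Field K] {V : Type*} [Finite V] (G : SimpleGraph V) :
    starPackingNumber G ≤
      polyDepth K V (MvPolynomial V K ⧸ symbolicPower (edgeIdeal K G) 2) + 1 := by
  classical
  have := Fintype.ofFinite V
  refine iSup₂_le fun F hF => ?_
  -- Stars are nonempty, so disjoint vertex sets are distinct; this makes the packing finite.
  have hinj : Set.InjOn (fun T : G.Subgraph => T.verts) F := by
    intro T hT T' hT' h
    by_contra hne
    obtain ⟨v, rfl⟩ := hF.1 T hT
    have hd : Disjoint (starSubgraph G v).verts T'.verts := hF.2 hT hT' hne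
    have h' : (starSubgraph G v).verts = T'.verts := h
    rw [← h'] at hd
    exact Set.disjoint_left.1 hd (Set.mem_insert _ _) (Set.mem_insert _ _)
  have hfin : F.Finite := Set.Finite.of_finite_image (Set.toFinite _) hinj
  obtain ⟨k, hk⟩ : ∃ k, F.ncard = k := ⟨_, rfl⟩
  rw [← hfin.cast_ncard_eq, hk]
  cases k with
  | zero => simp
  | succ n =>
    have := hfin.to_subtype
    let e : Fin (n + 1) ≃ F := (Finite.equivFinOfCardEq (by rw [Nat.card_coe_set_eq, hk])).symm
    choose c hc using fun i => hF.1 (e i) (e i).2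
    have hpair : Pairwise fun i j => Disjoint (closedNbhd G (c i)) (closedNbhd G (c j)) := by
      intro i j hij
      have := hF.2 (e i).2 (e j).2 fun h => hij (e.injective (Subtype.ext h))
      simp only [hc] at this
      exact this
    have hreg := isRegular_sumForms (K := K) hpair
    rw [Nat.cast_succ]
    have hlen : (sumForms K fun i => closedNbhd G (c i)).length = n := by simp [sumForms]
    have hle : (n : ℕ∞) ≤ polyDepth K V (MvPolynomial V K ⧸ symbolicPower (edgeIdeal K G) 2) :=
      le_iSup₂_of_le (f := fun (rs : List (MvPolynomial V K)) _ => (rs.length : ℕ∞)) _ hreg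
        (by rw [hlen])
    exact add_le_add_left hle 1
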